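/- **Model.** A job type is $\langle v_j,D_j,a_j,d_j\rangle$ (value, demand, arrival time, deadline) with $v_j,D_j>0$ and $0\le a_j\le d_j$. An instance $\tau$ is a finite set of jobs with types; its slackness is $s(\tau)=\min_j (d_j-a_j)/D_j$. A single server processes at most one job at a time, preemption is allowed, and a job is completed if it is processed for a total time of at least $D_j$ during $[a_j,d_j]$. A scheduling algorithm $\mathcal A$ is deterministic and online: what it does at time $t$ depends only on the jobs that arrive up to time $t$. Let $v(\mathcal A(\tau))$ be the total value of the jobs that $\mathcal A$ completes on $\tau$, $v(OPT(\tau))$ the optimal offline value, and $$\mathrm{cr}_{\mathcal A}(s)=\sup_{\tau:\,s(\tau)=s}\frac{v(OPT(\tau))}{v(\mathcal A(\tau))}.$$ Let $v(OPT^*(\tau))$ be the infimum of $\sum_j D_j\alpha_j+\int_0^\infty\beta(t)\,dt$ over all $\alpha_j\ge 0$ and measurable $\beta\ge 0$ with $\alpha_j+\beta(t)\ge v_j/D_j$ for all jobs $j$ and all $t\in[a_j,d_j]$. We say that $\mathcal A$ *induces an upper bound on the integrality gap at slackness $s$* if $v(OPT^*(\tau))/v(\mathcal A(\tau))\le \mathrm{cr}_{\mathcal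 A}(s)$ for every instance $\tau$ with $s(\tau)=s$. (As $v(\mathcal A(\tau))\le v(OPT(\tau))$, this gives $v(OPT^*(\tau))/v(OPT(\tau))\le\mathrm{cr}_{\mathcal A}(s)$.) A committed scheduler also announces decisions online. On inputs with $d_j-a_j\ge sD_j$ for every job, it is *$\beta$-responsive* if by time $d_j-\beta D_j$ it has irrevocably accepted or rejected each job $j$, every accepted job is completed by its deadline, and a rejected job is not processed any more. **Reduction.** Let $\omega\in(0,1)$. A simulator runs $\mathcal A$ on the virtual types $\langle v_j,\,D_j/\omega,\,a_j,\,d_j-\omega(d_j-a_j)\rangle$. A job is accepted (admitted to the real server) as soon as the simulator has completed it, and is rejected at its virtual deadline $d_j-\omega(d_j-a_j)$ if the simulator has not completed it by then. At every time the real server processes an admitted job, not yet fully processed, that has the earliest deadline among all such jobs (it is idle only if there is none; ties are broken in any online way). The resulting committed scheduler is denoted $\mathcal A_C$. **Theorem.** Let $s>0$, $\omega\in(0,1)$, and let $\mathcal A$ be a single server scheduling algorithm that induces an upper bound on the integrality gap at slackness $s\,\omega(1-\omega)$. Then the reduction can be carried out online, and every committed scheduler $\mathcal A_C$ obtained from $\mathcal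 A$ by it is $\omega s$-responsive on inputs with deadline slackness $s$, and $$\mathrm{cr}_{\mathcal A_C}(s)\;\le\;\frac{\mathrm{cr}_{\mathcal A}\big(s\,\omega(1-\omega)\big)}{\omega(1-\omega)}\qquad\text{if } s>\frac1{\omega(1-\omega)}.$$ -/

import Mathlib

open MeasureTheory Set
open scoped ENNReal NNReal

namespace Scheduling

/-- The type `⟨v, D, a, d⟩` of a job: value, demand, arrival time and deadline. -/
structure JobType where
  value : ℝ
  demand : ℝ
  arrival : ℝ
  deadline : ℝ
  value_pos : 0 < value
  demand_pos : 0 < demand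
  arrival_nonneg : 0 ≤ arrival
  arrival_le_deadline : arrival ≤ deadline

/-- An instance: a finite set of jobs (named by natural numbers) with their types. The values of
`type` outside `jobs` play no role. -/
structure Instance where
  jobs : Finset ℕ
  type : ℕ → JobType

namespace Instance

/-- The slackness of the instance is `s`: the minimum of `(d_j - a_j) / D_j` over its jobs. -/
def HasSlackness (τ : Instance) (s : ℝ) : Prop :=
  IsLeast ((fun j => ((τ.type j).deadline - (τ.type j).arrival) / (τ.type j).demand) ''
    (τ.jobs : Set ℕ)) s

/-- The jobs that arrive up to time `t` are the same, with the same types, in `τ` and `τ'`. -/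
def AgreeUpTo (τ τ' : Instance) (t : ℝ) : Prop :=
  ∀ j, ((j ∈ τ.jobs ∧ (τ.type j).arrival ≤ t) ↔ (j ∈ τ'.jobs ∧ (τ'.type j).arrival ≤ t)) ∧
    (j ∈ τ.jobs → (τ.type j).arrival ≤ t → τ.type j = τ'.type j)

end Instance

/-- What a single server does over time: at each time it is idle (`none`) or it processes one
job. -/
abbrev Schedule := ℝ → Option ℕ

namespace Schedule

/-- The set of times at which job `j` is processed. -/
def runTimes (σ : Schedule) (j : ℕ) : Set ℝ := {t | σ t = some j}

/-- Every job is processed on a measurable set of times. -/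
def IsMeasurable (σ : Schedule) : Prop := ∀ j, MeasurableSet (σ.runTimes j)

/-- Job `j` has received its full demand inside `[a_j, d_j]` by time `t`. -/
def CompletedBy (σ : Schedule) (τ : Instance) (j : ℕ) (t : ℝ) : Prop :=
  ENNReal.ofReal (τ.type j).demand ≤
    volume (σ.runTimes j ∩ Icc (τ.type j).arrival (min t (τ.type j).deadline))

/-- Job `j` is completed: it receives its full demand inside `[a_j, d_j]`. -/
def Completes (σ : Schedule) (τ : Instance) (j : ℕ) : Prop :=
  σ.CompletedBy τ j (τ.type j).deadline

open Classical in
/-- The total value of the jobs of `τ` that `σ` completes. -/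
noncomputable def value (σ : Schedule) (τ : Instance) : ℝ≥0∞ :=
  ∑ j ∈ τ.jobs.filter (fun j => σ.Completes τ j), ENNReal.ofReal (τ.type j).value

end Schedule

/-- The optimal offline value `v(OPT(τ))`. -/
noncomputable def optValue (τ : Instance) : ℝ≥0∞ :=
  ⨆ (σ : Schedule) (_ : σ.IsMeasurable), σ.value τ

/-- A (deterministic) single server scheduling algorithm produces a schedule for each instance. -/
abbrev Scheduler := Instance → Schedule

namespace Scheduler

/-- The algorithm produces measurable schedules, processes only jobs of the instance that have
already arrived, and what it does at time `t` depends only on the jobs that arrive up to `t`. -/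
structure IsOnline (A : Scheduler) : Prop where
  measurable : ∀ τ, (A τ).IsMeasurable
  arrived : ∀ τ t j, A τ t = some j → j ∈ τ.jobs ∧ (τ.type j).arrival ≤ t
  causal : ∀ τ τ' t, Instance.AgreeUpTo τ τ' t → A τ t = A τ' t

/-- The competitive ratio `cr_A(s)`: the worst ratio `v(OPT(τ)) / v(A(τ))` over the instances of
slackness `s` (infinite if unbounded, or if `A` gains nothing on one of them). -/
noncomputable def competitiveRatio (A : Scheduler) (s : ℝ) : ℝ≥0∞ :=
  ⨆ (τ : Instance) (_ : τ.HasSlackness s), optValue τ / (A τ).value τ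

end Scheduler

/-- Feasibility for the single server dual program:
`α_j + β(t) ≥ ρ_j = v_j / D_j` for every job `j` and every `t ∈ [a_j, d_j]`. -/
structure DualFeasible (τ : Instance) (α : ℕ → ℝ≥0) (β : ℝ → ℝ≥0) : Prop where
  measurable : Measurable β
  covers : ∀ j ∈ τ.jobs, ∀ t ∈ Icc (τ.type j).arrival (τ.type j).deadline,
    (τ.type j).value / (τ.type j).demand ≤ (α j : ℝ) + (β t : ℝ)

/-- The dual cost `∑ D_j α_j + ∫_0^∞ β(t) dt`. -/
noncomputable def dualCost (τ : Instance) (α : ℕ → ℝ≥0) (β : ℝ → ℝ≥0) : ℝ≥0∞ :=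
  ∑ j ∈ τ.jobs, ENNReal.ofReal (τ.type j).demand * (α j : ℝ≥0∞) +
    ∫⁻ t in Ici (0 : ℝ), (β t : ℝ≥0∞)

/-- The optimal fractional value `v(OPT*(τ))`: the optimal cost of the dual program. -/
noncomputable def fracOptValue (τ : Instance) : ℝ≥0∞ :=
  ⨅ (α : ℕ → ℝ≥0) (β : ℝ → ℝ≥0) (_ : DualFeasible τ α β), dualCost τ α β

/-- `A` induces an upper bound on the integrality gap at slackness `s`: on every instance of
slackness `s` the optimal fractional value is at most `cr_A(s)` times the value that `A` gains
(so that also `v(OPT*(τ)) / v(OPT(τ)) ≤ cr_A(s)`, because `v(A(τ)) ≤ v(OPT(τ))`). -/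
def Scheduler.InducesGapBound (A : Scheduler) (s : ℝ) : Prop :=
  ∀ τ : Instance, τ.HasSlackness s →
    fracOptValue τ / (A τ).value τ ≤ A.competitiveRatio s

/-- What a job has been told. -/
inductive Decision
  | pending
  | accepted
  | rejected

/-- A scheduler that announces decisions: `decision τ j t` is what job `j` of the instance `τ` has
been told by time `t`. -/
structure CommittedScheduler where
  run : Scheduler
  decision : Instance → ℕ → ℝ → Decision

namespace CommittedScheduler

/-- Both the schedule and the announcements are made online. -/
structure IsOnline (B : CommittedScheduler) : Prop where
  run_online : B.run.IsOnline
  decision_causal : ∀ τ τ' t, Instance.AgreeUpTo τ τ' t →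
    ∀ j ∈ τ.jobs, (τ.type j).arrival ≤ t → B.decision τ j t = B.decision τ' j t

/-- `β`-responsiveness on inputs with deadline slackness `s` (`d_j - a_j ≥ s D_j` for every job):
by time `d_j - β D_j` each job `j` is accepted or rejected; the decision is irrevocable; accepted
jobs are completed by their deadline; rejected jobs are not processed any more. -/
def IsResponsive (B : CommittedScheduler) (s β : ℝ) : Prop :=
  ∀ τ : Instance,
    (∀ j ∈ τ.jobs, s * (τ.type j).demand ≤ (τ.type j).deadline - (τ.type j).arrival) →
    ∀ j ∈ τ.jobs,
      B.decision τ j ((τ.type j).deadline - β * (τ.type j).demand) ≠ Decision.pending ∧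
      (∀ t t', t ≤ t' → B.decision τ j t ≠ Decision.pending →
        B.decision τ j t' = B.decision τ j t) ∧
      (∀ t, B.decision τ j t = Decision.accepted → (B.run τ).Completes τ j) ∧
      (∀ t, B.decision τ j t = Decision.rejected → ∀ u, t ≤ u → B.run τ u ≠ some j)

end CommittedScheduler

/-- The virtual type `⟨v, D / ω, a, d - ω (d - a)⟩`. -/
noncomputable def JobType.virt (ω : Ioo (0 : ℝ) 1) (x : JobType) : JobType where
  value := x.value
  demand := x.demand / ω
  arrival := x.arrival
  deadline := x.deadline - ω * (x.deadline - x.arrival)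
  value_pos := x.value_pos
  demand_pos := div_pos x.demand_pos ω.2.1
  arrival_nonneg := x.arrival_nonneg
  arrival_le_deadline := by nlinarith [x.arrival_le_deadline, ω.2.2]

/-- The virtual instance that is submitted to the simulator. -/
noncomputable def Instance.virt (ω : Ioo (0 : ℝ) 1) (τ : Instance) : Instance where
  jobs := τ.jobs
  type := fun j => (τ.type j).virt ω

/-- Job `j` of `τ` has been admitted by time `t`: the simulator, running `A` on the virtual
instance, has completed it by time `t` (and by its virtual deadline). -/
def Admitted (A : Scheduler) (ω : Ioo (0 : ℝ) 1) (τ : Instance) (j : ℕ) (t : ℝ) : Prop :=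
  j ∈ τ.jobs ∧ (A (τ.virt ω)).CompletedBy (τ.virt ω) j t

/-- Job `j` is waiting on the server at time `t`: it has been admitted by time `t`, and the server
has processed it for less than its demand before `t`. -/
def Waiting (A : Scheduler) (ω : Ioo (0 : ℝ) 1) (τ : Instance) (σ : Schedule) (j : ℕ) (t : ℝ) :
    Prop :=
  Admitted A ω τ j t ∧ volume (σ.runTimes j ∩ Iio t) < ENNReal.ofReal (τ.type j).demand

/-- `B` is obtained from `A` by the single server reduction with parameter `ω`: a job is accepted
when the simulator completes it, and is rejected at its virtual deadline if the simulator has not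
completed it by then; at each time the server processes a job with the earliest deadline among the
waiting jobs, and is idle only if there is none. -/
structure IsReduction (A : Scheduler) (ω : Ioo (0 : ℝ) 1) (B : CommittedScheduler) : Prop where
  accepted_iff : ∀ τ, ∀ j ∈ τ.jobs, ∀ t,
    B.decision τ j t = Decision.accepted ↔ Admitted A ω τ j t
  rejected_iff : ∀ τ, ∀ j ∈ τ.jobs, ∀ t,
    B.decision τ j t = Decision.rejected ↔
      ((τ.virt ω).type j).deadline ≤ t ∧ ¬ Admitted A ω τ j t
  edf : ∀ τ j t, B.run τ t = some j →
    Waiting A ω τ (B.run τ) j t ∧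
      ∀ k, Waiting A ω τ (B.run τ) k t → (τ.type j).deadline ≤ (τ.type k).deadline
  busy : ∀ τ k t, Waiting A ω τ (B.run τ) k t → B.run τ t ≠ none

end Scheduling

/-! Feasibility: suppose an admitted job misses its deadline `d`, and trace back to the start `t₁`
of the final period during which jobs due by `d` are always waiting. By EDF the server spends `[t₁,
d]` on jobs admitted after `t₁` and due by `d`, so their total demand exceeds `d - t₁`. Admission
after `t₁` happens before the virtual deadline, which forces arrival after `d - (d - t₁)/ω`; the
simulator has thus fitted `1/ω` times that demand into an interval of length `(d - t₁)/ω`, a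
contradiction (`IsReduction.completes`). So the server earns at least what `A` earns on the virtual
instance.

Ratio: a dual solution `(α, β)` of the virtual instance bounds the real optimum. Densities grow by
`1/ω`, so `α` and `β` are scaled by it; windows grow by `1/(1-ω)` to the right, so `β` is replaced
by an envelope on the stretched windows, at a cost factor of at most `1/(1-ω)`
(`lintegral_sup_stretch_le`, from a covering lemma on every level set). Weak duality gives `ω(1-ω)
OPT(τ) ≤ OPT*(virtual τ)`, and the gap bound for `A` finishes.

Existence of an EDF server in continuous time comes from recursion over jobs in order of priority,
not over time. -/

namespace Scheduling

/-! ### Accumulated processing time -/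

/-- The volume of `W ∩ (-∞, t)` grows at rate at most one in `t`. -/
theorem volume_inter_Iio_le_add (W : Set ℝ) (u t : ℝ) :
    volume (W ∩ Iio t) ≤ volume (W ∩ Iio u) + ENNReal.ofReal (t - u) := by
  refine (measure_mono (t := (W ∩ Iio u) ∪ Ico u t) ?_).trans ((measure_union_le _ _).trans ?_)
  · rintro x ⟨hx, hxt⟩
    rcases lt_or_ge x u with h | h
    · exact Or.inl ⟨hx, h⟩
    · exact Or.inr ⟨h, hxt⟩
  · rw [Real.volume_Ico]

theorem volume_inter_Iic (W : Set ℝ) (t : ℝ) : volume (W ∩ Iic t) = volume (W ∩ Iio t) :=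
  measure_congr ((ae_eq_refl W).inter Iio_ae_eq_Iic.symm)

theorem volume_inter_Iio_mono (W : Set ℝ) {u t : ℝ} (h : u ≤ t) :
    volume (W ∩ Iio u) ≤ volume (W ∩ Iio t) :=
  measure_mono (inter_subset_inter_right _ (Iio_subset_Iio h))

/-- The times by which a set that is bounded below has accumulated a positive volume `D` form a
closed half-line. -/
theorem exists_le_volume_inter_Iio_iff {W : Set ℝ} {a : ℝ} (hW : W ⊆ Ici a) {D : ℝ≥0∞}
    (hD : 0 < D) {t₀ : ℝ} (h₀ : D ≤ volume (W ∩ Iio t₀)) :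
    ∃ c, ∀ t, D ≤ volume (W ∩ Iio t) ↔ c ≤ t := by
  set X := {t | D ≤ volume (W ∩ Iio t)} with hX
  have hb : BddBelow X := by
    refine ⟨a, fun t ht => ?_⟩
    by_contra! hlt
    have : W ∩ Iio t = ∅ := by
      ext x
      simp only [mem_inter_iff, mem_Iio, mem_empty_iff_false, iff_false, not_and, not_lt]
      exact fun hx => hlt.le.trans (hW hx)
    rw [hX, mem_ofPred_eq, this, measure_empty] at ht
    exact absurd hD (not_lt.2 ht)
  refine ⟨sInf X, fun t => ⟨fun h => csInf_le hb h, fun h => ?_⟩⟩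
  refine le_trans ?_ (volume_inter_Iio_mono W h)
  -- The infimum itself qualifies: a member of `X` within `ε` of it has gained at most `ε` more
  -- volume.
  refine ENNReal.le_of_forall_pos_le_add fun ε hε _ => ?_
  obtain ⟨x, hx, hlt⟩ := exists_lt_of_csInf_lt (s := X) ⟨t₀, h₀⟩
    (lt_add_of_pos_right (sInf X) (NNReal.coe_pos.2 hε))
  refine (show D ≤ _ from hx).trans ((volume_inter_Iio_le_add W (sInf X) x).trans ?_)
  gcongr
  rw [← ENNReal.ofReal_coe_nnreal]
  exact ENNReal.ofReal_le_ofReal (by linarith)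

/-- A set that stops once it has accumulated the volume `D` has volume at most `D`. -/
theorem volume_inter_Iic_le {R : Set ℝ} {D : ℝ≥0∞}
    (h : ∀ t ∈ R, volume (R ∩ Iio t) ≤ D) (T : ℝ) : volume (R ∩ Iic T) ≤ D := by
  rcases (R ∩ Iic T).eq_empty_or_nonempty with he | hne
  · simp [he]
  have hb : BddAbove (R ∩ Iic T) := ⟨T, fun x hx => hx.2⟩
  refine ENNReal.le_of_forall_pos_le_add fun ε hε _ => ?_
  obtain ⟨x, hx, hlt⟩ := exists_lt_of_lt_csSup hne
    (sub_lt_self (sSup (R ∩ Iic T)) (NNReal.coe_pos.2 hε))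
  refine (measure_mono (t := R ∩ Iic (sSup (R ∩ Iic T)))
    fun y hy => ⟨hy.1, le_csSup hb hy⟩).trans ?_
  rw [volume_inter_Iic]
  refine (volume_inter_Iio_le_add R x _).trans ?_
  gcongr
  · exact h x hx.1
  · rw [← ENNReal.ofReal_coe_nnreal]
    exact ENNReal.ofReal_le_ofReal (by linarith)

/-- Using the available times `W` until the volume `D` is accumulated: the used part has volume
less than `D` before `t` exactly if the available part has. -/
theorem volume_used_lt_iff {W : Set ℝ} {a : ℝ} (hW : W ⊆ Ici a) {D : ℝ≥0∞} (hD : 0 < D) (t : ℝ) :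
    volume ({u ∈ W | volume (W ∩ Iio u) < D} ∩ Iio t) < D ↔ volume (W ∩ Iio t) < D := by
  refine ⟨fun h => ?_, fun h => (measure_mono ?_).trans_lt h⟩
  swap
  · exact fun x hx => ⟨hx.1.1, hx.2⟩
  contrapose! h
  -- Before the threshold time `c` every available time is used, and this already has volume `D`.
  obtain ⟨c, hc⟩ := exists_le_volume_inter_Iio_iff hW hD h
  refine ((hc c).2 le_rfl).trans (measure_mono ?_)
  rintro x ⟨hx, hxc : x < c⟩
  exact ⟨⟨hx, not_le.1 fun h' => absurd ((hc x).1 h') (not_le.2 hxc)⟩,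
    hxc.trans_le ((hc t).1 h)⟩

/-! ### Stretching a union of intervals -/

/-- Stretching finitely many intervals to the right by a factor `K` increases the length of their
union at most by this factor. -/
theorem volume_iUnion_stretch_le {K : ℝ} (hK : 1 ≤ K) (S : Finset (ℝ × ℝ)) :
    (∀ p ∈ S, p.1 ≤ p.2) →
    volume (⋃ p ∈ S, Icc p.1 (p.1 + K * (p.2 - p.1))) ≤
      ENNReal.ofReal K * volume (⋃ p ∈ S, Icc p.1 p.2) := by
  classical
  induction hn : S.card using Nat.strong_induction_on generalizing S with
  | _ n ih =>
  intro hS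
  by_cases hd : (S : Set (ℝ × ℝ)).PairwiseDisjoint fun p => Icc p.1 p.2
  · rw [measure_biUnion_finset hd fun _ _ => measurableSet_Icc, Finset.mul_sum]
    refine (measure_biUnion_finset_le _ _).trans (Finset.sum_le_sum fun p hp => ?_)
    rw [Real.volume_Icc, Real.volume_Icc, ← ENNReal.ofReal_mul (by linarith)]
    exact ENNReal.ofReal_le_ofReal (by linarith)
  · simp only [PairwiseDisjoint, Set.Pairwise, Function.onFun, not_forall] at hd
    obtain ⟨p, hp, q, hq, hpq, hx⟩ := hd
    obtain ⟨x, hxp, hxq⟩ := not_disjoint_iff.1 hx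
    -- Two intervals that meet are replaced by their hull: the union is unchanged, the stretched
    -- union does not shrink, and there are fewer intervals.
    set r : ℝ × ℝ := (min p.1 q.1, max p.2 q.2) with hr
    set T := insert r ((S.erase p).erase q) with hT
    have hcard : T.card < n := by
      have h1 : ((S.erase p).erase q).card = S.card - 1 - 1 := by
        rw [Finset.card_erase_of_mem (Finset.mem_erase.2 ⟨hpq.symm, hq⟩),
          Finset.card_erase_of_mem hp]
      have h2 : 1 < S.card := Finset.one_lt_card.2 ⟨p, hp, q, hq, hpq⟩
      have h3 : T.card ≤ _ := Finset.card_insert_le r ((S.erase p).erase q)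
      omega
    have hrle : r.1 ≤ r.2 := (min_le_left _ _).trans ((hS p hp).trans (le_max_left _ _))
    have key : ∀ i : ℝ × ℝ, r.1 ≤ i.1 → i.2 ≤ r.2 →
        Icc i.1 (i.1 + K * (i.2 - i.1)) ⊆ Icc r.1 (r.1 + K * (r.2 - r.1)) := by
      intro i h1 h2
      refine Icc_subset_Icc h1 ?_
      -- The stretched right end is `K * i.2 - (K - 1) * i.1`, which `1 ≤ K` makes monotone under
      -- enlarging the interval.
      nlinarith
    have h1 := ih _ hcard T rfl (by
      intro i hi
      rcases Finset.mem_insert.1 hi with rfl | hi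
      · exact hrle
      · exact hS i (Finset.mem_of_mem_erase (Finset.mem_of_mem_erase hi)))
    refine (measure_mono ?_).trans (h1.trans ?_)
    · refine iUnion₂_subset fun i hi => ?_
      by_cases hip : i = p
      · subst hip
        exact (key i (min_le_left _ _) (le_max_left _ _)).trans
          (subset_biUnion_of_mem (u := fun p : ℝ × ℝ => Icc p.1 (p.1 + K * (p.2 - p.1)))
            (Finset.mem_insert_self r _))
      by_cases hiq : i = q
      · subst hiq
        exact (key i (min_le_right _ _) (le_max_right _ _)).trans
          (subset_biUnion_of_mem (u := fun p : ℝ × ℝ => Icc p.1 (p.1 + K * (p.2 - p.1)))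
            (Finset.mem_insert_self r _))
      · exact subset_biUnion_of_mem (u := fun p : ℝ × ℝ => Icc p.1 (p.1 + K * (p.2 - p.1)))
          (Finset.mem_insert_of_mem (Finset.mem_erase.2 ⟨hiq, Finset.mem_erase.2 ⟨hip, hi⟩⟩))
    · gcongr ENNReal.ofReal K * volume ?_
      refine iUnion₂_subset fun i hi => ?_
      rcases Finset.mem_insert.1 hi with rfl | hi
      · intro y hy
        have hy1 : min p.1 q.1 ≤ y := hy.1
        have hy2 : y ≤ max p.2 q.2 := hy.2
        simp only [mem_iUnion]
        rcases le_total y x with hyx | hyx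
        · rcases min_le_iff.1 hy1 with h | h
          · exact ⟨p, hp, h, hyx.trans hxp.2⟩
          · exact ⟨q, hq, h, hyx.trans hxq.2⟩
        · rcases le_max_iff.1 hy2 with h | h
          · exact ⟨p, hp, hxp.1.trans hyx, h⟩
          · exact ⟨q, hq, hxq.1.trans hyx, h⟩
      · exact subset_biUnion_of_mem (u := fun p : ℝ × ℝ => Icc p.1 p.2)
          (Finset.mem_of_mem_erase (Finset.mem_of_mem_erase hi))

/-! ### Causality and admission times -/

namespace Instance

theorem AgreeUpTo.symm {τ τ' : Instance} {t : ℝ} (h : AgreeUpTo τ τ' t) : AgreeUpTo τ' τ t :=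
  fun j => ⟨(h j).1.symm, fun hj ht =>
    let hj' := (h j).1.2 ⟨hj, ht⟩
    ((h j).2 hj'.1 hj'.2).symm⟩

theorem AgreeUpTo.mono {τ τ' : Instance} {t u : ℝ} (h : AgreeUpTo τ τ' t) (hu : u ≤ t) :
    AgreeUpTo τ τ' u := by
  refine fun j => ⟨⟨fun ⟨hj, ha⟩ => ?_, fun ⟨hj, ha⟩ => ?_⟩, fun hj ha => (h j).2 hj (ha.trans hu)⟩
  · exact ⟨((h j).1.1 ⟨hj, ha.trans hu⟩).1, (h j).2 hj (ha.trans hu) ▸ ha⟩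
  · exact ⟨((h j).1.2 ⟨hj, ha.trans hu⟩).1, (h.symm j).2 hj (ha.trans hu) ▸ ha⟩

theorem AgreeUpTo.virt {τ τ' : Instance} {t : ℝ} (h : AgreeUpTo τ τ' t) (ω : Ioo (0 : ℝ) 1) :
    AgreeUpTo (τ.virt ω) (τ'.virt ω) t :=
  fun j => ⟨(h j).1, fun hj ha => congrArg (JobType.virt ω) ((h j).2 hj ha)⟩

end Instance

namespace Schedule

theorem CompletedBy.mono {σ : Schedule} {τ : Instance} {j : ℕ} {t u : ℝ}
    (h : σ.CompletedBy τ j t) (htu : t ≤ u) : σ.CompletedBy τ j u :=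
  h.trans (measure_mono (inter_subset_inter_right _
    (Icc_subset_Icc_right (min_le_min_right _ htu))))

theorem CompletedBy.completes {σ : Schedule} {τ : Instance} {j : ℕ} {t : ℝ}
    (h : σ.CompletedBy τ j t) : σ.Completes τ j :=
  h.trans (measure_mono (inter_subset_inter_right _
    (Icc_subset_Icc_right (by simp))))

/-- Moving the time cap into a half-line, up to a null set, gives the form to which the threshold
lemma applies. -/
theorem completedBy_iff (σ : Schedule) (τ : Instance) (j : ℕ) (t : ℝ) :
    σ.CompletedBy τ j t ↔ ENNReal.ofReal (τ.type j).demand ≤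
      volume ((σ.runTimes j ∩ Icc (τ.type j).arrival (τ.type j).deadline) ∩ Iio t) := by
  rw [CompletedBy, ← volume_inter_Iic, inter_assoc]
  congr! 3
  ext x
  simp only [mem_inter_iff, mem_Icc, mem_Iic, le_min_iff]
  tauto

theorem CompletedBy.arrival_le {σ : Schedule} {τ : Instance} {j : ℕ} {t : ℝ}
    (h : σ.CompletedBy τ j t) : (τ.type j).arrival ≤ t := by
  by_contra! hlt
  rw [CompletedBy, Icc_eq_empty (by simp [hlt]), inter_empty, measure_empty] at h
  exact absurd (ENNReal.ofReal_pos.2 (τ.type j).demand_pos) (not_lt.2 h)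

theorem exists_completedBy_iff {σ : Schedule} {τ : Instance} {j : ℕ} {t₀ : ℝ}
    (h : σ.CompletedBy τ j t₀) : ∃ c, ∀ t, σ.CompletedBy τ j t ↔ c ≤ t := by
  simp only [completedBy_iff] at h ⊢
  exact exists_le_volume_inter_Iio_iff (fun x hx => hx.2.1)
    (ENNReal.ofReal_pos.2 (τ.type j).demand_pos) h

end Schedule

section Admission

variable {A : Scheduler} {ω : Ioo (0 : ℝ) 1} {τ τ' : Instance} {j k : ℕ} {t u : ℝ}

theorem Admitted.mono (h : Admitted A ω τ j t) (htu : t ≤ u) : Admitted A ω τ j u :=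
  ⟨h.1, h.2.mono htu⟩

theorem Admitted.arrival_le (h : Admitted A ω τ j t) : (τ.type j).arrival ≤ t :=
  h.2.arrival_le

/-- Only processing inside the virtual window counts, so no admission can come later than the
virtual deadline. -/
theorem Admitted.at_virt_deadline (h : Admitted A ω τ j t) :
    Admitted A ω τ j ((τ.virt ω).type j).deadline :=
  ⟨h.1, h.2.completes⟩

theorem exists_admitted_iff (h : Admitted A ω τ j t) : ∃ c, ∀ u, Admitted A ω τ j u ↔ c ≤ u := by
  obtain ⟨c, hc⟩ := Schedule.exists_completedBy_iff h.2
  exact ⟨c, fun u => ⟨fun hu => (hc u).1 hu.2, fun hu => ⟨h.1, (hc u).2 hu⟩⟩⟩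

theorem Admitted.type_eq (h : Admitted A ω τ j t) (hag : Instance.AgreeUpTo τ τ' t) :
    τ.type j = τ'.type j :=
  (hag j).2 h.1 h.arrival_le

/-- Completion by `t` only involves what the simulator does up to `t`, and a completed job has
already arrived, so its type is shared. -/
theorem Admitted.of_agreeUpTo (hA : A.IsOnline) (h : Admitted A ω τ j t)
    (hag : Instance.AgreeUpTo τ τ' t) : Admitted A ω τ' j t := by
  refine ⟨((hag j).1.1 ⟨h.1, h.arrival_le⟩).1, ?_⟩
  have hty : (τ'.virt ω).type j = (τ.virt ω).type j :=
    congrArg (JobType.virt ω) (h.type_eq hag).symm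
  have h2 := h.2
  rw [Schedule.CompletedBy] at h2 ⊢
  rw [hty]
  refine h2.trans (measure_mono ?_)
  rintro x ⟨hx, hx1, hx2⟩
  refine ⟨?_, hx1, hx2⟩
  rw [Schedule.runTimes, mem_ofPred_eq] at hx ⊢
  rw [← hx]
  exact (hA.causal _ _ x ((hag.mono (hx2.trans (min_le_left _ _))).virt ω)).symm

theorem admitted_congr (hA : A.IsOnline) (hag : Instance.AgreeUpTo τ τ' t) :
    Admitted A ω τ j t ↔ Admitted A ω τ' j t :=
  ⟨fun h => h.of_agreeUpTo hA hag, fun h => h.of_agreeUpTo hA hag.symm⟩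

end Admission

/-! ### Construction of the earliest deadline first server -/

/-- Job `k` of `τ` has priority over job `j`: it has an earlier deadline, or the same deadline and
a smaller name. -/
def Precedes (τ : Instance) (k j : ℕ) : Prop :=
  k ∈ τ.jobs ∧ toLex ((τ.type k).deadline, k) < toLex ((τ.type j).deadline, j)

theorem Precedes.trans {τ : Instance} {i k j : ℕ} (h : Precedes τ i k) (h' : Precedes τ k j) :
    Precedes τ i j :=
  ⟨h.1, h.2.trans h'.2⟩

theorem Precedes.irrefl {τ : Instance} {j : ℕ} : ¬ Precedes τ j j := fun h => lt_irrefl _ h.2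

theorem precedes_or {τ : Instance} {k j : ℕ} (hk : k ∈ τ.jobs) (hj : j ∈ τ.jobs) (h : k ≠ j) :
    Precedes τ k j ∨ Precedes τ j k := by
  have hne : toLex ((τ.type k).deadline, k) ≠ toLex ((τ.type j).deadline, j) := fun h' =>
    h (congrArg (fun x => (ofLex x).2) h')
  exact (lt_or_gt_of_ne hne).imp (fun h => ⟨hk, h⟩) fun h => ⟨hj, h⟩

theorem deadline_le_of_not_precedes {τ : Instance} {k j : ℕ} (hk : k ∈ τ.jobs)
    (h : ¬ Precedes τ k j) : (τ.type j).deadline ≤ (τ.type k).deadline := by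
  by_contra! hlt
  exact h ⟨hk, Prod.Lex.toLex_lt_toLex.2 (Or.inl hlt)⟩

theorem wellFounded_precedes (τ : Instance) : WellFounded (Precedes τ) := by
  classical
  refine Subrelation.wf (r := InvImage (· < ·) fun j => (τ.jobs.filter (Precedes τ · j)).card)
    (fun {k j} h => ?_) (InvImage.wf _ Nat.lt_wfRel.wf)
  refine Finset.card_lt_card ⟨fun i hi => ?_, fun hsub => ?_⟩
  · rw [Finset.mem_filter] at hi ⊢
    exact ⟨hi.1, hi.2.trans h⟩
  · exact Precedes.irrefl (Finset.mem_filter.1 (hsub (Finset.mem_filter.2 ⟨h.1, h⟩))).2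

/-- The times at which job `j` is served when the server follows the priorities: the times at which
`j` has been admitted and no job with priority over `j` is served, until the demand is reached. -/
noncomputable def served (A : Scheduler) (ω : Ioo (0 : ℝ) 1) (τ : Instance) : ℕ → Set ℝ :=
  (wellFounded_precedes τ).fix fun j ih =>
    {t ∈ {u | Admitted A ω τ j u ∧ ∀ k, ∀ h : Precedes τ k j, u ∉ ih k h} |
      volume ({u | Admitted A ω τ j u ∧ ∀ k, ∀ h : Precedes τ k j, u ∉ ih k h} ∩ Iio t) <
        ENNReal.ofReal (τ.type j).demand}

/-- The times at which `j` has been admitted and no job with priority over `j` is served. -/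
def available (A : Scheduler) (ω : Ioo (0 : ℝ) 1) (τ : Instance) (j : ℕ) : Set ℝ :=
  {u | Admitted A ω τ j u ∧ ∀ k, Precedes τ k j → u ∉ served A ω τ k}

section EDF

variable {A : Scheduler} {ω : Ioo (0 : ℝ) 1} {τ τ' : Instance} {j k : ℕ} {t u : ℝ}

theorem served_eq (A : Scheduler) (ω : Ioo (0 : ℝ) 1) (τ : Instance) (j : ℕ) :
    served A ω τ j = {t ∈ available A ω τ j |
      volume (available A ω τ j ∩ Iio t) < ENNReal.ofReal (τ.type j).demand} := by
  rw [served, WellFounded.fix_eq]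
  rfl

theorem served_subset_available : served A ω τ j ⊆ available A ω τ j := by
  rw [served_eq]
  exact fun _ h => h.1

theorem admitted_of_mem_served (h : t ∈ served A ω τ j) : Admitted A ω τ j t :=
  (served_subset_available h).1

theorem eq_of_mem_served (hj : t ∈ served A ω τ j) (hk : t ∈ served A ω τ k) : k = j := by
  by_contra hne
  rcases precedes_or (admitted_of_mem_served hk).1 (admitted_of_mem_served hj).1 hne with h | h
  · exact (served_subset_available hj).2 k h hk
  · exact (served_subset_available hk).2 j h hj

theorem measurableSet_served (A : Scheduler) (ω : Ioo (0 : ℝ) 1) (τ : Instance) (j : ℕ) :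
    MeasurableSet (served A ω τ j) := by
  induction j using (wellFounded_precedes τ).induction with
  | _ j ih =>
  have h1 : MeasurableSet {u | Admitted A ω τ j u} :=
    OrdConnected.measurableSet ⟨fun x hx y _ z hz => Admitted.mono hx hz.1⟩
  have h2 : MeasurableSet (available A ω τ j) := by
    have : available A ω τ j =
        {u | Admitted A ω τ j u} ∩ ⋂ k, ⋂ _ : Precedes τ k j, (served A ω τ k)ᶜ := by
      ext u
      simp [available]
    rw [this]
    exact h1.inter (MeasurableSet.iInter fun k => MeasurableSet.iInter fun h => (ih k h).compl)
  rw [served_eq]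
  refine h2.inter (OrdConnected.measurableSet ⟨fun x _ y hy z hz => ?_⟩)
  exact (volume_inter_Iio_mono _ hz.2).trans_lt hy

/-- Links the remaining demand in `Waiting`, measured by service received, to the recursion, which
measures it by availability and so avoids a circular definition. -/
theorem volume_served_lt_iff : volume (served A ω τ j ∩ Iio t) < ENNReal.ofReal (τ.type j).demand ↔
    volume (available A ω τ j ∩ Iio t) < ENNReal.ofReal (τ.type j).demand := by
  rw [served_eq]
  exact volume_used_lt_iff (fun x hx => hx.1.arrival_le)
    (ENNReal.ofReal_pos.2 (τ.type j).demand_pos) t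

/-- Induction on priority: only admitted jobs can block, these have arrived, and so their priorities
agree in both instances. -/
theorem mem_served_congr (hA : A.IsOnline) (hag : Instance.AgreeUpTo τ τ' t)
    (j : ℕ) : ∀ u ≤ t, u ∈ served A ω τ j ↔ u ∈ served A ω τ' j := by
  induction j using (wellFounded_precedes τ).induction with
  | _ j ih =>
  intro u hu
  by_cases had : Admitted A ω τ j u
  swap
  · exact iff_of_false (fun h => had (admitted_of_mem_served h))
      fun h => had ((admitted_of_mem_served h).of_agreeUpTo hA (hag.mono hu).symm)
  have htj := had.type_eq (hag.mono hu)
  have hav : ∀ x ≤ u, x ∈ available A ω τ j ↔ x ∈ available A ω τ' j := by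
    intro x hx
    have hxt := hag.mono (hx.trans hu)
    refine and_congr (admitted_congr hA hxt) (forall_congr' fun k => ?_)
    refine ⟨fun h hp hk => ?_, fun h hp hk => ?_⟩
    · have hak := (admitted_of_mem_served hk).of_agreeUpTo hA hxt.symm
      have hp' : Precedes τ k j := ⟨hak.1, by rw [htj, hak.type_eq hxt]; exact hp.2⟩
      exact h hp' ((ih k hp' x (hx.trans hu)).2 hk)
    · have hak := (admitted_of_mem_served hk).of_agreeUpTo hA hxt
      refine h ⟨hak.1, ?_⟩ ((ih k hp x (hx.trans hu)).1 hk)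
      rw [← htj, hak.type_eq hxt.symm]
      exact hp.2
  have hset : available A ω τ j ∩ Iio u = available A ω τ' j ∩ Iio u := by
    ext x
    exact and_congr_left fun hx => hav x (le_of_lt hx)
  rw [served_eq, served_eq, mem_ofPred_eq, mem_ofPred_eq, hset, htj, hav u le_rfl]

open Classical in
/-- The earliest deadline first schedule of the admitted jobs. -/
noncomputable def edfSchedule (A : Scheduler) (ω : Ioo (0 : ℝ) 1) : Scheduler := fun τ t =>
  if h : ∃ j, t ∈ served A ω τ j then some h.choose else none

theorem edfSchedule_eq_some : edfSchedule A ω τ t = some j ↔ t ∈ served A ω τ j := by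
  rw [edfSchedule]
  split_ifs with h
  · rw [Option.some_inj]
    exact ⟨fun h' => h' ▸ h.choose_spec, fun h' => eq_of_mem_served h' h.choose_spec⟩
  · exact iff_of_false (by simp) fun h' => h ⟨j, h'⟩

theorem edfSchedule_runTimes : (edfSchedule A ω τ).runTimes j = served A ω τ j :=
  Set.ext fun _ => edfSchedule_eq_some

theorem edfSchedule_isOnline (hA : A.IsOnline) : (edfSchedule A ω).IsOnline where
  measurable τ j := by
    rw [edfSchedule_runTimes]
    exact measurableSet_served A ω τ j
  arrived τ t j h :=
    have h' := admitted_of_mem_served (edfSchedule_eq_some.1 h)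
    ⟨h'.1, h'.arrival_le⟩
  causal τ τ' t h := by
    refine Option.ext fun j => ?_
    rw [edfSchedule_eq_some, edfSchedule_eq_some]
    exact mem_served_congr hA h j t le_rfl

theorem waiting_edfSchedule_iff : Waiting A ω τ (edfSchedule A ω τ) j t ↔
    Admitted A ω τ j t ∧
      volume (available A ω τ j ∩ Iio t) < ENNReal.ofReal (τ.type j).demand := by
  rw [Waiting, edfSchedule_runTimes, volume_served_lt_iff]

/-- A waiting job is either free to run or blocked by a served job of higher priority; this yields
both the EDF rule and the absence of idling. -/
theorem exists_served_of_waiting (h : Waiting A ω τ (edfSchedule A ω τ) k t) :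
    ∃ i, (i = k ∨ Precedes τ i k) ∧ t ∈ served A ω τ i := by
  rw [waiting_edfSchedule_iff] at h
  by_cases hk : t ∈ available A ω τ k
  · exact ⟨k, Or.inl rfl, by rw [served_eq]; exact ⟨hk, h.2⟩⟩
  · have : ¬ ∀ i, Precedes τ i k → t ∉ served A ω τ i := fun h' => hk ⟨h.1, h'⟩
    push Not at this
    obtain ⟨i, hi, hs⟩ := this
    exact ⟨i, Or.inr hi, hs⟩

open Classical in
/-- The committed scheduler that accepts a job when the simulator completes it, rejects it at its
virtual deadline otherwise, and serves the accepted jobs by earliest deadline. -/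
noncomputable def reduction (A : Scheduler) (ω : Ioo (0 : ℝ) 1) : CommittedScheduler where
  run := edfSchedule A ω
  decision τ j t :=
    if Admitted A ω τ j t then Decision.accepted
    else if ((τ.virt ω).type j).deadline ≤ t then Decision.rejected
    else Decision.pending

theorem reduction_isOnline (hA : A.IsOnline) : (reduction A ω).IsOnline where
  run_online := edfSchedule_isOnline hA
  decision_causal τ τ' t h j hj ha := by
    have hty : (τ.virt ω).type j = (τ'.virt ω).type j :=
      congrArg (JobType.virt ω) ((h j).2 hj ha)
    have had := admitted_congr (ω := ω) (j := j) hA h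
    by_cases h' : Admitted A ω τ' j t <;> simp [reduction, had, h', hty]

theorem reduction_isReduction (A : Scheduler) (ω : Ioo (0 : ℝ) 1) :
    IsReduction A ω (reduction A ω) where
  accepted_iff τ j _ t := by
    simp only [reduction]
    split_ifs <;> simp [*]
  rejected_iff τ j _ t := by
    simp only [reduction]
    split_ifs <;> simp [*]
  edf τ j t h := by
    have hs : t ∈ served A ω τ j := edfSchedule_eq_some.1 h
    refine ⟨waiting_edfSchedule_iff.2 ?_, fun k hk => ?_⟩
    · rw [served_eq] at hs
      exact ⟨hs.1.1, hs.2⟩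
    · obtain ⟨i, hi, hsi⟩ := exists_served_of_waiting hk
      obtain rfl := eq_of_mem_served hs hsi
      rcases hi with rfl | hi
      · exact le_rfl
      · exact deadline_le_of_not_precedes hk.1.1 fun h' => Precedes.irrefl (hi.trans h')
  busy τ k t hk h := by
    obtain ⟨i, -, hsi⟩ := exists_served_of_waiting hk
    have := edfSchedule_eq_some.2 hsi
    exact absurd (h.symm.trans this) (by simp)

end EDF

/-! ### Admitted jobs meet their deadlines -/

namespace IsReduction

variable {A : Scheduler} {ω : Ioo (0 : ℝ) 1} {B : CommittedScheduler} {τ : Instance} {j : ℕ}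
  {t : ℝ}

theorem volume_runTimes_le (hB : IsReduction A ω B) (τ : Instance) (j : ℕ) (T : ℝ) :
    volume ((B.run τ).runTimes j ∩ Iic T) ≤ ENNReal.ofReal (τ.type j).demand :=
  volume_inter_Iic_le (fun t ht => (hB.edf τ j t ht).1.2.le) T

/-- The earliest deadline first server completes every admitted job by its deadline. -/
theorem completes (hA : A.IsOnline) (hB : IsReduction A ω B) (hj : Admitted A ω τ j t) :
    (B.run τ).Completes τ j := by
  classical
  by_contra hn
  set σ := B.run τ with hσ
  set d := (τ.type j).deadline with hd
  have hω0 : (0 : ℝ) < ω := ω.2.1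
  have hω1 : (ω : ℝ) < 1 := ω.2.2
  have hlt : volume (σ.runTimes j ∩ Iic d) < ENNReal.ofReal (τ.type j).demand := by
    rw [Schedule.Completes, Schedule.CompletedBy, not_le] at hn
    refine (measure_mono ?_).trans_lt hn
    rintro x ⟨hx, hxd⟩
    exact ⟨hx, (hB.edf τ j x hx).1.1.arrival_le, by simpa using hxd⟩
  have hvd : ∀ k, ((τ.virt ω).type k).deadline ≤ (τ.type k).deadline := fun k =>
    sub_le_self _ (mul_nonneg hω0.le (sub_nonneg.2 (τ.type k).arrival_le_deadline))
  have hex : ∀ k, ∃ c, (∃ u, Admitted A ω τ k u) → ∀ u, Admitted A ω τ k u ↔ c ≤ u := by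
    intro k
    by_cases h : ∃ u, Admitted A ω τ k u
    · obtain ⟨u, hu⟩ := h
      obtain ⟨c, hc⟩ := exists_admitted_iff hu
      exact ⟨c, fun _ => hc⟩
    · exact ⟨0, fun h' => absurd h' h⟩
  choose c hc using hex
  have hcv : ∀ k, (∃ u, Admitted A ω τ k u) → c k ≤ ((τ.virt ω).type k).deadline :=
    fun k ⟨u, hu⟩ => (hc k ⟨u, hu⟩ _).1 hu.at_virt_deadline
  set P : ℝ → Prop := fun u => ∃ k, (τ.type k).deadline ≤ d ∧ Waiting A ω τ σ k u with hP
  -- Admission times from which a job due by `d` waits at every moment until `d`; the earliest one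
  -- starts the busy period. Times after `d` qualify vacuously, but the minimum is at most `c j ≤
  -- d`.
  set C := τ.jobs.filter fun k => (∃ u, Admitted A ω τ k u) ∧ ∀ u ∈ Icc (c k) d, P u with hC
  have hjC : j ∈ C := by
    refine Finset.mem_filter.2 ⟨hj.1, ⟨t, hj⟩, fun u hu => ⟨j, le_rfl, ?_, ?_⟩⟩
    · exact (hc j ⟨t, hj⟩ u).2 hu.1
    · exact (measure_mono (inter_subset_inter_right _
        fun x (hx : x < u) => hx.le.trans hu.2)).trans_lt hlt
  obtain ⟨k₀, hk₀, hmin⟩ := C.exists_min_image c ⟨j, hjC⟩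
  have hbusy := (Finset.mem_filter.1 hk₀).2.2
  set t₁ := c k₀ with ht₁
  set S := τ.jobs.filter fun k =>
    (∃ u, Admitted A ω τ k u) ∧ (τ.type k).deadline ≤ d ∧ t₁ ≤ c k with hS
  have hjS : j ∈ S := Finset.mem_filter.2 ⟨hj.1, ⟨t, hj⟩, le_rfl, hmin j hjC⟩
  have ht₁d : t₁ ≤ d := (hmin j hjC).trans ((hcv j ⟨t, hj⟩).trans (hvd j))
  have hcover : Icc t₁ d ⊆ ⋃ k ∈ S, σ.runTimes k ∩ Iic d := by
    intro u hu
    obtain ⟨k, hkd, hkw⟩ := hbusy u hu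
    obtain ⟨i, hi⟩ := Option.ne_none_iff_exists'.1 (hB.busy τ k u hkw)
    obtain ⟨hiw, hie⟩ := hB.edf τ i u hi
    have hid := (hie k hkw).trans hkd
    have hia : ∃ u, Admitted A ω τ i u := ⟨u, hiw.1⟩
    simp only [mem_iUnion]
    refine ⟨i, Finset.mem_filter.2 ⟨hiw.1.1, hia, hid, ?_⟩, hi, hu.2⟩
    -- If `i` had been admitted before `t₁`, it would have been waiting from then until `u`, so the
    -- busy period would start earlier.
    by_contra! hlt'
    refine absurd (hmin i (Finset.mem_filter.2 ⟨hiw.1.1, hia, fun x hx => ?_⟩)) (not_le.2 hlt')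
    rcases le_total x u with hxu | hxu
    · exact ⟨i, hid, (hc i hia x).2 hx.1, (volume_inter_Iio_mono _ hxu).trans_lt hiw.2⟩
    · exact hbusy x ⟨hu.1.trans hxu, hx.2⟩
  -- Strict because `j` receives less than its demand, while no job receives more than its own.
  have hreal : ENNReal.ofReal (d - t₁) < ENNReal.ofReal (∑ k ∈ S, (τ.type k).demand) := by
    rw [ENNReal.ofReal_sum_of_nonneg fun k _ => (τ.type k).demand_pos.le, ← Real.volume_Icc]
    refine (measure_mono hcover).trans_lt ((measure_biUnion_finset_le _ _).trans_lt ?_)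
    rw [← Finset.add_sum_erase _ _ hjS, ← Finset.add_sum_erase _ _ hjS]
    refine ENNReal.add_lt_add_of_lt_of_le ?_ hlt
      (Finset.sum_le_sum fun k _ => hB.volume_runTimes_le τ k d)
    exact (ENNReal.sum_lt_top.2 fun k _ =>
      (hB.volume_runTimes_le τ k d).trans_lt ENNReal.ofReal_lt_top).ne
  have hvirt : ENNReal.ofReal (∑ k ∈ S, (τ.type k).demand / ω) ≤
      ENNReal.ofReal ((d - t₁) / ω) := by
    have hsub : ∀ k ∈ S, ENNReal.ofReal ((τ.type k).demand / ω) ≤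
        volume ((A (τ.virt ω)).runTimes k ∩ Icc (d - (d - t₁) / ω) d) := by
      intro k hk
      obtain ⟨-, ⟨u, hu⟩, hkd, hkt⟩ := Finset.mem_filter.1 hk
      have h1 := hcv k ⟨u, hu⟩
      refine hu.at_virt_deadline.2.trans (measure_mono (inter_subset_inter_right _ ?_))
      refine Icc_subset_Icc ?_ ((min_le_left _ _).trans ((hvd k).trans hkd))
      -- From `t₁ ≤ d_k - ω (d_k - a_k)` one gets `a_k ≥ d_k - (d_k - t₁)/ω`, and this bound
      -- decreases in `d_k ≤ d`.
      change d - (d - t₁) / ω ≤ (τ.type k).arrival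
      replace h1 : t₁ ≤ (τ.type k).deadline - ω * ((τ.type k).deadline - (τ.type k).arrival) :=
        hkt.trans h1
      rw [sub_le_iff_le_add, ← sub_le_iff_le_add', le_div_iff₀ hω0]
      nlinarith
    rw [ENNReal.ofReal_sum_of_nonneg fun k _ => (div_pos (τ.type k).demand_pos hω0).le]
    refine (Finset.sum_le_sum hsub).trans ?_
    rw [← measure_biUnion_finset]
    · refine (measure_mono (iUnion₂_subset fun k _ => inter_subset_right)).trans ?_
      rw [Real.volume_Icc, sub_sub_cancel]
    · intro k _ i _ hki
      refine disjoint_left.2 fun x hx hx' => hki (Option.some_injective _ ?_)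
      exact (show _ = _ from hx.1).symm.trans hx'.1
    · exact fun k _ => (hA.measurable _ k).inter measurableSet_Icc
  have h1 := (ENNReal.ofReal_lt_ofReal_iff_of_nonneg (sub_nonneg.2 ht₁d)).1 hreal
  have h2 := (ENNReal.ofReal_le_ofReal_iff (div_nonneg (sub_nonneg.2 ht₁d) hω0.le)).1 hvirt
  rw [← Finset.sum_div, div_le_div_iff_of_pos_right hω0] at h2
  exact absurd h1 (not_lt.2 h2)

/-- Slackness gives `ω (d_j - a_j) ≥ ω s D_j`, so the virtual deadline, when every job is settled,
is early enough. -/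
theorem isResponsive (hA : A.IsOnline) (hB : IsReduction A ω B) (s : ℝ) :
    B.IsResponsive s (ω * s) := by
  intro τ hτ j hj
  have hω0 : (0 : ℝ) < ω := ω.2.1
  refine ⟨fun hp => ?_, fun t t' htt' hp => ?_, fun t ht => ?_, fun t ht u htu hu => ?_⟩
  · by_cases h : Admitted A ω τ j ((τ.type j).deadline - ω * s * (τ.type j).demand)
    · exact absurd (((hB.accepted_iff τ j hj _).2 h).symm.trans hp) (by simp)
    · refine absurd (((hB.rejected_iff τ j hj _).2 ⟨?_, h⟩).symm.trans hp) (by simp)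
      change (τ.type j).deadline - ω * ((τ.type j).deadline - (τ.type j).arrival) ≤ _
      nlinarith [hτ j hj]
  · cases h : B.decision τ j t with
    | pending => exact absurd h hp
    | accepted =>
      exact (hB.accepted_iff τ j hj t').2 (((hB.accepted_iff τ j hj t).1 h).mono htt')
    | rejected =>
      obtain ⟨h1, h2⟩ := (hB.rejected_iff τ j hj t).1 h
      exact (hB.rejected_iff τ j hj t').2
        ⟨h1.trans htt', fun h' => h2 (h'.at_virt_deadline.mono h1)⟩
  · exact hB.completes hA ((hB.accepted_iff τ j hj t).1 ht)
  · obtain ⟨h1, h2⟩ := (hB.rejected_iff τ j hj t).1 ht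
    exact h2 ((hB.edf τ j u hu).1.1.at_virt_deadline.mono h1)

theorem value_virt_le (hA : A.IsOnline) (hB : IsReduction A ω B) (τ : Instance) :
    (A (τ.virt ω)).value (τ.virt ω) ≤ (B.run τ).value τ := by
  classical
  refine Finset.sum_le_sum_of_subset fun j hj => ?_
  obtain ⟨h1, h2⟩ := Finset.mem_filter.1 hj
  exact Finset.mem_filter.2 ⟨h1, hB.completes hA ⟨h1, h2⟩⟩

end IsReduction

/-! ### From the virtual dual to the real optimum -/

/-- If `β` is at least `m j` on each interval `[a j, e j]`, then the upper envelope of the constants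
`m j` on these intervals stretched by a factor `K` costs at most `K` times as much as `β`. -/
theorem lintegral_sup_stretch_le (J : Finset ℕ) {a e : ℕ → ℝ} (ha : ∀ j, 0 ≤ a j)
    (hae : ∀ j, a j ≤ e j) {K : ℝ} (hK : 1 ≤ K) (m : ℕ → ℝ≥0) {β : ℝ → ℝ≥0}
    (hβ : Measurable β) (hm : ∀ j ∈ J, ∀ t ∈ Icc (a j) (e j), m j ≤ β t) :
    ∫⁻ t, ((J.sup fun j => (Icc (a j) (a j + K * (e j - a j))).indicator (fun _ => m j) t : ℝ≥0) :
      ℝ≥0∞) ≤ ENNReal.ofReal K * ∫⁻ t in Ici (0 : ℝ), (β t : ℝ≥0∞) := by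
  classical
  set g : ℝ → ℝ≥0 :=
    fun t => J.sup fun j => (Icc (a j) (a j + K * (e j - a j))).indicator (fun _ => m j) t with hg
  have hgm : Measurable g := by
    have : g = J.sup fun j => (Icc (a j) (a j + K * (e j - a j))).indicator (fun _ => m j) := by
      ext t
      simp [hg, Finset.sup_apply]
    rw [this]
    exact Finset.sup_induction (p := Measurable) measurable_const (fun _ h _ h' => h.sup h')
      fun j _ => measurable_const.indicator measurableSet_Icc
  have layer : ∀ (μ : Measure ℝ) (f : ℝ → ℝ≥0), Measurable f →
      ∫⁻ t, (f t : ℝ≥0∞) ∂μ = ∫⁻ l in Ioi (0 : ℝ), μ {t | l < (f t : ℝ)} := by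
    intro μ f hf
    simpa using lintegral_eq_lintegral_meas_lt μ (f := fun t => (f t : ℝ))
      (Filter.Eventually.of_forall fun t => (f t).2) hf.coe_nnreal_real.aemeasurable
  -- Layer cake: at level `l` the envelope exceeds `l` only on stretched windows with `m j > l`, and
  -- `β` exceeds `l` on the unstretched ones.
  rw [layer _ g hgm, layer _ β hβ, ← lintegral_const_mul' _ _ ENNReal.ofReal_ne_top]
  refine setLIntegral_mono' measurableSet_Ioi fun l hl => ?_
  replace hl : 0 < l := hl
  set S := (J.filter fun j => l < m j).image fun j => (a j, e j) with hS
  have h := volume_iUnion_stretch_le hK S (by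
    intro p hp
    obtain ⟨j, -, rfl⟩ := Finset.mem_image.1 hp
    exact hae j)
  refine (measure_mono ?_).trans (h.trans ?_)
  · intro t ht
    have ht' : Real.toNNReal l < g t := (Real.toNNReal_lt_iff_lt_coe hl.le).2 ht
    obtain ⟨j, hj, hlt⟩ := (Finset.lt_sup_iff).1 ht'
    have hmem : t ∈ Icc (a j) (a j + K * (e j - a j)) := by
      by_contra hn
      rw [indicator_of_notMem hn] at hlt
      exact absurd hlt (by simp)
    rw [indicator_of_mem hmem] at hlt
    exact mem_biUnion (Finset.mem_coe.2 (Finset.mem_image_of_mem _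
      (Finset.mem_filter.2 ⟨hj, (Real.toNNReal_lt_iff_lt_coe hl.le).1 hlt⟩))) hmem
  · rw [Measure.restrict_apply' measurableSet_Ici]
    gcongr
    refine iUnion₂_subset fun p hp => ?_
    obtain ⟨j, hj, rfl⟩ := Finset.mem_image.1 hp
    obtain ⟨hj, hlt⟩ := Finset.mem_filter.1 hj
    intro t ht
    exact ⟨hlt.trans_le (NNReal.coe_le_coe.2 (hm j hj t ht)), (ha j).trans ht.1⟩

/-- Weak duality: if `α j + m j` covers the density of each job `j`, then no schedule gains more than
the cost of `α` and of the upper envelope of the constants `m j` on the intervals `[a_j, d_j]`. -/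
theorem Schedule.value_le {σ : Schedule} (hσ : σ.IsMeasurable) (τ : Instance) (α m : ℕ → ℝ≥0)
    (h : ∀ j ∈ τ.jobs, (τ.type j).value ≤ (τ.type j).demand * (α j + m j)) :
    σ.value τ ≤ ∑ j ∈ τ.jobs, ENNReal.ofReal (τ.type j).demand * (α j : ℝ≥0∞) +
      ∫⁻ t, ((τ.jobs.sup fun j =>
        (Icc (τ.type j).arrival (τ.type j).deadline).indicator (fun _ => m j) t : ℝ≥0) : ℝ≥0∞) := by
  classical
  set g : ℝ → ℝ≥0 := fun t => τ.jobs.sup fun j =>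
    (Icc (τ.type j).arrival (τ.type j).deadline).indicator (fun _ => m j) t with hg
  set C := τ.jobs.filter fun j => σ.Completes τ j with hC
  set R : ℕ → Set ℝ := fun j => σ.runTimes j ∩ Icc (τ.type j).arrival (τ.type j).deadline with hR
  have hRm : ∀ j, MeasurableSet (R j) := fun j => (hσ j).inter measurableSet_Icc
  have h1 : ∀ j ∈ C, ENNReal.ofReal (τ.type j).value ≤
      ENNReal.ofReal (τ.type j).demand * (α j : ℝ≥0∞) + ∫⁻ t in R j, (g t : ℝ≥0∞) := by
    intro j hj
    obtain ⟨hj, hc⟩ := Finset.mem_filter.1 hj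
    refine (ENNReal.ofReal_le_ofReal (h j hj)).trans ?_
    rw [ENNReal.ofReal_mul (τ.type j).demand_pos.le, ENNReal.ofReal_add (α j).coe_nonneg (m j).coe_nonneg,
      ENNReal.ofReal_coe_nnreal, ENNReal.ofReal_coe_nnreal, mul_add]
    gcongr
    rw [Schedule.Completes, Schedule.CompletedBy, min_self] at hc
    calc ENNReal.ofReal (τ.type j).demand * (m j : ℝ≥0∞)
        ≤ volume (R j) * (m j : ℝ≥0∞) := by gcongr
      _ = ∫⁻ _ in R j, (m j : ℝ≥0∞) := by rw [setLIntegral_const, mul_comm]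
      _ ≤ ∫⁻ t in R j, (g t : ℝ≥0∞) := by
        refine setLIntegral_mono' (hRm j) fun t ht => ENNReal.coe_le_coe.2 ?_
        have := Finset.le_sup (f := fun j =>
          (Icc (τ.type j).arrival (τ.type j).deadline).indicator (fun _ => m j) t) hj
        simp only [indicator_of_mem ht.2] at this
        exact this
  refine (Finset.sum_le_sum h1).trans ?_
  rw [Finset.sum_add_distrib]
  gcongr ?_ + ?_
  · exact Finset.sum_le_sum_of_subset (Finset.filter_subset _ _)
  -- A single server processes one job at a time, so the sets `R j` are disjoint and their integrals
  -- add up to at most the whole.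
  · rw [← lintegral_biUnion_finset]
    · exact setLIntegral_le_lintegral _ _
    · intro k _ i _ hki
      refine disjoint_left.2 fun x hx hx' => hki (Option.some_injective _ ?_)
      exact (show _ = _ from hx.1).symm.trans hx'.1
    · exact fun j _ => hRm j

/-- The optimal value is at most `1 / (ω (1 - ω))` times the optimal fractional value of the virtual
instance. -/
theorem ofReal_mul_optValue_le (ω : Ioo (0 : ℝ) 1) (τ : Instance) :
    ENNReal.ofReal (ω * (1 - ω)) * optValue τ ≤ fracOptValue (τ.virt ω) := by
  have hω0 : (0 : ℝ) < ω := ω.2.1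
  have hω1 : (0 : ℝ) < 1 - ω := sub_pos.2 ω.2.2
  refine le_iInf fun α => le_iInf fun β => le_iInf fun hαβ => ?_
  simp only [optValue, ENNReal.mul_iSup]
  refine iSup_le fun σ => iSup_le fun hσ => ?_
  -- The part of the virtual density that `α j` leaves uncovered, which `β` must supply throughout
  -- the virtual window.
  set m : ℕ → ℝ≥0 := fun j =>
    Real.toNNReal ((τ.type j).value / ((τ.type j).demand / ω) - α j) with hm
  obtain ⟨w, hw⟩ : ∃ w : ℝ≥0, (w : ℝ) = (ω : ℝ)⁻¹ :=
    ⟨_, Real.coe_toNNReal _ (inv_pos.2 hω0).le⟩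
  have hcov : ∀ j ∈ τ.jobs, (τ.type j).value ≤
      (τ.type j).demand * ((w * α j : ℝ≥0) + (w * m j : ℝ≥0)) := by
    intro j _
    have h1 : (τ.type j).value / ((τ.type j).demand / ω) - α j ≤ m j := Real.le_coe_toNNReal _
    have h2 : (τ.type j).value / ((τ.type j).demand / ω) ≤ α j + m j := by linarith
    rw [div_le_iff₀ (div_pos (τ.type j).demand_pos hω0)] at h2
    refine h2.trans_eq ?_
    push_cast
    rw [hw]
    ring
  have hβ : ∀ j ∈ τ.jobs, ∀ t ∈ Icc ((τ.virt ω).type j).arrival ((τ.virt ω).type j).deadline,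
      w * m j ≤ w * β t := by
    intro j hj t ht
    gcongr
    refine Real.toNNReal_le_iff_le_coe.2 ?_
    have := hαβ.covers j hj t ht
    change (τ.type j).value / ((τ.type j).demand / ω) ≤ _ at this
    linarith
  have h1 := Schedule.value_le hσ τ (fun j => w * α j) (fun j => w * m j) hcov
  have h2 := lintegral_sup_stretch_le τ.jobs (fun j => (τ.type j).arrival_nonneg)
    (fun j => ((τ.virt ω).type j).arrival_le_deadline)
    ((one_le_inv₀ hω1).2 (by linarith)) (fun j => w * m j) (hαβ.measurable.const_mul w) hβ
  -- The virtual window has length `(1 - ω)(d_j - a_j)`, so the stretch by `1/(1 - ω)` recovers the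
  -- real window exactly.
  have hend : ∀ j, (τ.type j).arrival + (1 - (ω : ℝ))⁻¹ *
      (((τ.virt ω).type j).deadline - (τ.type j).arrival) = (τ.type j).deadline := by
    intro j
    change (τ.type j).arrival + (1 - (ω : ℝ))⁻¹ * ((τ.type j).deadline -
      ω * ((τ.type j).deadline - (τ.type j).arrival) - (τ.type j).arrival) = _
    field_simp
    ring
  change ∫⁻ t, ((τ.jobs.sup fun j => (Icc (τ.type j).arrival ((τ.type j).arrival +
    (1 - (ω : ℝ))⁻¹ * (((τ.virt ω).type j).deadline - (τ.type j).arrival))).indicator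
      (fun _ => w * m j) t : ℝ≥0) : ℝ≥0∞) ≤ _ at h2
  simp only [hend] at h2
  have hwE : (w : ℝ≥0∞) = ENNReal.ofReal (ω : ℝ)⁻¹ := by
    rw [← hw, ENNReal.ofReal_coe_nnreal]
  have hwint : ∫⁻ t in Ici (0 : ℝ), ((w * β t : ℝ≥0) : ℝ≥0∞) =
      ENNReal.ofReal (ω : ℝ)⁻¹ * ∫⁻ t in Ici (0 : ℝ), (β t : ℝ≥0∞) := by
    simp only [ENNReal.coe_mul]
    rw [lintegral_const_mul' _ _ ENNReal.coe_ne_top, hwE]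
  rw [hwint] at h2
  refine (mul_le_mul_right (h1.trans (add_le_add_right h2 _)) _).trans ?_
  -- The `α` part has room to spare (`1 - ω` against `1/ω`); in the `β` part the factors cancel
  -- exactly.
  rw [mul_add, dualCost]
  gcongr ?_ + ?_
  · rw [Finset.mul_sum]
    refine Finset.sum_le_sum fun j _ => ?_
    change _ ≤ ENNReal.ofReal ((τ.type j).demand / ω) * _
    rw [ENNReal.coe_mul, ← mul_assoc, ← mul_assoc, hwE,
      ← ENNReal.ofReal_mul (by positivity),
      ← ENNReal.ofReal_mul (mul_nonneg (by positivity) (τ.type j).demand_pos.le)]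
    gcongr
    have : ω * (1 - ω) * (τ.type j).demand * (ω : ℝ)⁻¹ = (1 - ω) * (τ.type j).demand := by
      field_simp
    rw [this, le_div_iff₀ hω0]
    nlinarith [mul_le_of_le_one_left (τ.type j).demand_pos.le
      (mul_le_one₀ (sub_le_self 1 hω0.le) hω0.le ω.2.2.le)]
  · rw [← mul_assoc, ← mul_assoc, ← ENNReal.ofReal_mul (by positivity),
      ← ENNReal.ofReal_mul (by positivity)]
    have : ω * (1 - ω) * (1 - (ω : ℝ))⁻¹ * (ω : ℝ)⁻¹ = 1 := by field_simp
    rw [this, ENNReal.ofReal_one, one_mul]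

/-! ### Competitive ratio -/

/-- The window shrinks by `1 - ω` and the demand grows by `1/ω`, so every job's ratio is scaled by
the same factor and the minimum is too. -/
theorem Instance.HasSlackness.virt {τ : Instance} {s : ℝ} (h : τ.HasSlackness s)
    (ω : Ioo (0 : ℝ) 1) : (τ.virt ω).HasSlackness (s * (ω * (1 - ω))) := by
  have hω0 : (0 : ℝ) < ω := ω.2.1
  have hω1 : (0 : ℝ) < 1 - ω := sub_pos.2 ω.2.2
  have hmono : Monotone fun x : ℝ => x * (ω * (1 - ω)) := fun x y hxy =>
    mul_le_mul_of_nonneg_right hxy (by positivity)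
  have := hmono.map_isLeast h
  rw [image_image] at this
  refine (congrArg (IsLeast · _) (image_congr fun j _ => ?_)).mpr this
  change ((τ.type j).deadline - ω * ((τ.type j).deadline - (τ.type j).arrival) -
    (τ.type j).arrival) / ((τ.type j).demand / ω) = _
  have := (τ.type j).demand_pos
  field_simp
  ring

/-- The numerator is bounded by duality and the denominator by the jobs the simulator completes;
both then refer to the virtual instance, where the gap bound applies. -/
theorem IsReduction.competitiveRatio_le {A : Scheduler} (hA : A.IsOnline) {ω : Ioo (0 : ℝ) 1}
    {B : CommittedScheduler} (hB : IsReduction A ω B) {s : ℝ}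
    (hgap : A.InducesGapBound (s * ((ω : ℝ) * (1 - ω)))) :
    B.run.competitiveRatio s ≤
      A.competitiveRatio (s * ((ω : ℝ) * (1 - ω))) / ENNReal.ofReal ((ω : ℝ) * (1 - ω)) := by
  have hpos : (0 : ℝ) < ω * (1 - ω) := mul_pos ω.2.1 (sub_pos.2 ω.2.2)
  refine iSup_le fun τ => iSup_le fun hτ => ?_
  rw [ENNReal.le_div_iff_mul_le (Or.inl (ENNReal.ofReal_pos.2 hpos).ne')
    (Or.inl ENNReal.ofReal_ne_top), mul_comm, ← mul_div_assoc]
  exact (ENNReal.div_le_div (ofReal_mul_optValue_le ω τ) (hB.value_virt_le hA τ)).trans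
    (hgap _ (hτ.virt ω))

end Scheduling

theorem mainTheorem5 (A : Scheduling.Scheduler) (hA : A.IsOnline)
    (ω : Set.Ioo (0 : ℝ) 1) (s : ℝ) (hs : 0 < s)
    (hgap : A.InducesGapBound (s * ((ω : ℝ) * (1 - ω)))) :
    (∃ B : Scheduling.CommittedScheduler, B.IsOnline ∧ Scheduling.IsReduction A ω B) ∧
    ∀ B : Scheduling.CommittedScheduler, B.IsOnline → Scheduling.IsReduction A ω B →
      B.IsResponsive s ((ω : ℝ) * s) ∧
      (1 / ((ω : ℝ) * (1 - ω)) < s →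
        B.run.competitiveRatio s ≤
          A.competitiveRatio (s * ((ω : ℝ) * (1 - ω))) /
            ENNReal.ofReal ((ω : ℝ) * (1 - ω))) :=
  ⟨⟨Scheduling.reduction A ω, Scheduling.reduction_isOnline hA,
    Scheduling.reduction_isReduction A ω⟩,
    fun _ _ hB => ⟨hB.isResponsive hA s, fun _ => hB.competitiveRatio_le hA hgap⟩⟩
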